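/- Let $d\in\mathbb{N}$ and let $K\subseteq\mathbb{R}^d$ be compact (with the Euclidean metric). A multifunction $f\colon K\rightrightarrows\mathbb{R}$ assigns to every $x\in K$ a nonempty set $f(x)\subseteq\mathbb{R}$. It *maps compact sets to compact sets* if $f[S]=\bigcup_{x\in S}f(x)$ is compact for every compact $S\subseteq K$. A multifunction $g\colon K\rightrightarrows\mathbb{R}$ *tightens* $f$ if $g(x)\subseteq f(x)$ for all $x\in K$. A *name* of a real number $t$ is a sequence of integer fractions $(a_n/b_n)_{n\in\mathbb{N}}$ with $|t-a_n/b_n|\le 2^{-n}$ for all $n$; a name of $x\in\mathbb{R}^d$ consists of one name for each of its $d$ coordinates. For an oracle $\mathcal{O}$ (a set of finite strings, equivalently of natural numbers), $f$ is *computable relative to $\mathcal{O}$* if there is a machine with oracle $\mathcal{O}$ which, for every $x\in K$ and every name of $x$ given as its infinite input, computes a name of some $y\in f(x)$; the value $y$ may depend on the given name of $x$. $f$ is *relatively computable* if it is computable relative to some oracle. $f$ is *$\omega$-fold Henkin-continuous* if there are $\delta_1,\delta_2,\ldots>0$ such that $$\forall x_1\in K\;\exists y_1\in\mathbb{R}\;\forall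 x_2\in K\;\exists y_2\in\mathbb{R}\;\cdots:\quad y_1\in f(x_1)\;\wedge\;\bigwedge_{\ell\ge1}\Big(|x_{\ell+1}-x_\ell|\le\delta_\ell\;\rightarrow\; y_{\ell+1}\in f(x_{\ell+1})\wedge|y_{\ell+1}-y_\ell|\le2^{-\ell}\Big),$$ where the infinite quantifier prefix means that the player choosing $y_1,y_2,\ldots$ has a winning strategy in the corresponding infinite two-player game (each $y_\ell$ being chosen knowing only the moves made before it). Then the following hold. (a) If $f\colon K\rightrightarrows\mathbb{R}$ is computable relative to an oracle $\mathcal{O}$, then there is $g\colon K\rightrightarrows\mathbb{R}$ that tightens $f$, is computable relative to the same oracle $\mathcal{O}$, and maps compact sets to compact sets. (b) If $f\colon K\rightrightarrows\mathbb{R}$ is relatively computable, then it is $\omega$-fold Henkin-continuous. (c) If $f\colon K\rightrightarrows\mathbb{R}$ maps compact sets to compact sets and is $\omega$-fold Henkin-continuous, then $f$ is relatively computable. -/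

import Mathlib

/-! ### Multifunctions -/

/-- A (possibly partial) multifunction from `X` to `Y`, viewed as a set-valued map. -/
abbrev Multifunction (X Y : Type*) := X → Set Y

namespace Multifunction

variable {X Y : Type*}

/-- The domain: the points at which `f` has at least one value. -/
def dom (f : Multifunction X Y) : Set X := {x | (f x).Nonempty}

/-- `f` is total if it has at least one value at every point. -/
def IsTotal (f : Multifunction X Y) : Prop := f.dom = Set.univ

/-- The image `f[S]`, the union of all `f x` with `x ∈ S`. -/
def image (f : Multifunction X Y) (S : Set X) : Set Y := ⋃ x ∈ S, f x

/-- `g` tightens `f`. -/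
def Tightens (g f : Multifunction X Y) : Prop :=
  f.dom ⊆ g.dom ∧ ∀ x ∈ f.dom, g x ⊆ f x

/-- `f` maps compact sets to compact sets. -/
def MapsCompactToCompact [TopologicalSpace X] [TopologicalSpace Y]
    (f : Multifunction X Y) : Prop :=
  ∀ S : Set X, IsCompact S → IsCompact (f.image S)

/-- `ω`-fold Henkin-continuity.  There are `δ₁, δ₂, … > 0` such that the second player wins the
infinite game in which the first player plays `x₁`, the second `y₁`, the first `x₂`, the second
`y₂`, and so on, the second player winning the run iff `y₁ ∈ f x₁` and, for all `ℓ ≥ 1`,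
if `x_{ℓ+1}` is in the closed ball of radius `δ_ℓ` around `x_ℓ`, then `y_{ℓ+1} ∈ f x_{ℓ+1}` and
`y_{ℓ+1}` is in the closed ball of radius `2^{-ℓ}` around `y_ℓ`.
A strategy of the second player is a family `s` giving his `n`-th answer as a function of the
first `n` moves of his opponent.
All indices are shifted by one: `x n`, `y n`, `δ n` stand for `x_{n+1}`, `y_{n+1}`, `δ_{n+1}`. -/
def OmegaHenkinContinuous [MetricSpace X] [MetricSpace Y] (f : Multifunction X Y) : Prop :=
  ∃ δ : ℕ → ℝ, (∀ n, 0 < δ n) ∧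
    ∃ s : (n : ℕ) → (Fin (n + 1) → X) → Y,
      ∀ (x : ℕ → X) (y : ℕ → Y), (∀ n, y n = s n (fun i => x i)) →
        y 0 ∈ f (x 0) ∧
        ∀ n, x (n + 1) ∈ Metric.closedBall (x n) (δ n) →
          y (n + 1) ∈ f (x (n + 1)) ∩ Metric.closedBall (y n) ((2 : ℝ)⁻¹ ^ (n + 1))

end Multifunction

/-! ### Oracle computations on infinite inputs -/

/-- `OracleComputable O Φ`: the functional `Φ`, taking `d` infinite sequences of natural numbers
(the input tapes) and an index `m` to the `m`-th output symbol (if the computation halts), is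
computable by one machine with oracle `O`.
This is the class of functionals that are partial recursive uniformly in the inputs: it is
generated, as in `Nat.RecursiveIn`, by the basic functions, membership queries to the oracle and
reading of the input tapes, under pairing, composition, primitive recursion and minimization.
Oracles are sets of natural numbers, which stand for finite strings. -/
inductive OracleComputable {d : ℕ} (O : Set ℕ) : ((Fin d → ℕ → ℕ) → ℕ →. ℕ) → Prop
  | zero : OracleComputable O fun _ _ => Part.some 0
  | succ : OracleComputable O fun _ n => Part.some (n + 1)
  | left : OracleComputable O fun _ n => Part.some n.unpair.1
  | right : OracleComputable O fun _ n => Part.some n.unpair.2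
  | oracle : OracleComputable O fun _ n => Part.some (O.indicator (fun _ => 1) n)
  | input (i : Fin d) : OracleComputable O fun p n => Part.some (p i n)
  | pair {Φ Ψ : (Fin d → ℕ → ℕ) → ℕ →. ℕ} (hΦ : OracleComputable O Φ)
      (hΨ : OracleComputable O Ψ) :
      OracleComputable O fun p n => Nat.pair <$> Φ p n <*> Ψ p n
  | comp {Φ Ψ : (Fin d → ℕ → ℕ) → ℕ →. ℕ} (hΦ : OracleComputable O Φ)
      (hΨ : OracleComputable O Ψ) :
      OracleComputable O fun p n => Ψ p n >>= Φ p
  | prec {Φ Ψ : (Fin d → ℕ → ℕ) → ℕ →. ℕ} (hΦ : OracleComputable O Φ)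
      (hΨ : OracleComputable O Ψ) :
      OracleComputable O fun p k =>
        let (a, n) := Nat.unpair k
        n.rec (Φ p a) fun y IH => do
          let i ← IH
          Ψ p (Nat.pair a (Nat.pair y i))
  | rfind {Φ : (Fin d → ℕ → ℕ) → ℕ →. ℕ} (hΦ : OracleComputable O Φ) :
      OracleComputable O fun p a =>
        Nat.rfind fun n => (fun m => m = 0) <$> Φ p (Nat.pair a n)

/-- The integer fraction `a / b` (with `b > 0`) coded by a natural number. -/
def fractionOfCode (c : ℕ) : ℚ :=
  (Equiv.intEquivNat.symm c.unpair.1 : ℚ) / ((c.unpair.2 : ℚ) + 1)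

/-- The sequence of fractions coded by `p` is a name of the real number `x`. -/
def IsName (p : ℕ → ℕ) (x : ℝ) : Prop :=
  ∀ n, |x - (fractionOfCode (p n) : ℝ)| ≤ (2 : ℝ)⁻¹ ^ n

namespace Multifunction

variable {d : ℕ} {K : Set (EuclideanSpace ℝ (Fin d))}

/-- `f` is computable relative to the oracle `O`: some machine with oracle `O` converts any name
of any `x` in the domain of `f` (one sequence for each coordinate) into a name of some value
`y ∈ f x` (which may depend on the given name of `x`). -/
def ComputableRelativeTo (O : Set ℕ) (f : Multifunction K ℝ) : Prop :=
  ∃ Φ : (Fin d → ℕ → ℕ) → ℕ →. ℕ, OracleComputable O Φ ∧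
    ∀ x ∈ f.dom, ∀ p : Fin d → ℕ → ℕ, (∀ i, IsName (p i) ((x : EuclideanSpace ℝ (Fin d)) i)) →
      ∃ q : ℕ → ℕ, (∀ m, q m ∈ Φ p m) ∧ ∃ y ∈ f x, IsName q y

/-- `f` is relatively computable: computable relative to some oracle. -/
def RelativelyComputable (f : Multifunction K ℝ) : Prop :=
  ∃ O : Set ℕ, f.ComputableRelativeTo O

end Multifunction

/-!
Names of a point `x` are first replaced, computably, by *dyadic* names, whose `n`-th entry has
denominator `2 ^ (n + 1)` (`roundName`).  The dyadic names of the points of a compact set form a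
compact set (`isCompact_setOf_isDyadicName`), on which a machine has, for each output index, a
uniform bound on the number of input symbols it reads (`OracleComputable.exists_modulus`).

* A computable `f` is tightened by the multifunction of all values which its machine computes from
  dyadic names of `x`.  Values depend continuously on names, so that the image of a compact set is
  the continuous image of a compact set of names.
* If `f` is relatively computable, the second player maintains a dyadic name of the current point,
  and answers with the value computed from it.  After a short move of his opponent he keeps so much
  of the name that the value changes by no more than the game permits, and he completes it by a
  name of the new point.  The lengths `δ n` are summable and so small that kept entries never
  exceed the tolerance of a name (`isDyadicName_strategyName`).  After a long move he starts a new
  name.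
* Conversely, a winning strategy is applied to points `X p n` which depend on an initial segment of
  the name `p` of `x` and converge fast to `x`.  The answers converge, and the limit is in `f x`:
  the opponent could jump to `x` at any stage, so `f x` has points arbitrarily close to the
  answers, and it is closed as the image of the compact set `{x}`.  All of this can be encoded in an
  oracle, since a functional each of whose outputs depends on an initial segment of the input, of
  length fixed in advance, is computable relative to some oracle
  (`OracleComputable.exists_of_modulus`).
-/

/-! ### Closure and continuity properties of oracle computations -/

open Filter Topology

namespace OracleComputable

variable {d : ℕ} {O : Set ℕ}

theorem of_partrec {f : ℕ →. ℕ} (hf : Nat.Partrec f) :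
    OracleComputable O fun (_ : Fin d → ℕ → ℕ) => f := by
  induction hf with
  | zero => exact zero
  | succ => exact succ
  | left => exact left
  | right => exact right
  | pair _ _ h₁ h₂ => exact pair h₁ h₂
  | comp _ _ h₁ h₂ => exact comp h₁ h₂
  | prec _ _ h₁ h₂ => exact prec h₁ h₂
  | rfind _ h => exact rfind h

theorem of_primrec {f : ℕ → ℕ} (hf : Nat.Primrec f) :
    OracleComputable O fun (_ : Fin d → ℕ → ℕ) n => Part.some (f n) :=
  of_partrec (Nat.Partrec.of_primrec hf)

theorem of_eq {Φ Ψ : (Fin d → ℕ → ℕ) → ℕ →. ℕ} (hΦ : OracleComputable O Φ)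
    (h : ∀ p n, Φ p n = Ψ p n) : OracleComputable O Ψ :=
  (funext fun p => funext (h p) : Φ = Ψ) ▸ hΦ

theorem pair_some {t u : (Fin d → ℕ → ℕ) → ℕ → ℕ}
    (ht : OracleComputable O fun p n => Part.some (t p n))
    (hu : OracleComputable O fun p n => Part.some (u p n)) :
    OracleComputable O fun p n => Part.some (Nat.pair (t p n) (u p n)) :=
  (pair ht hu).of_eq fun p n =>
    Part.bind_some (Nat.pair (t p n)) fun g => (Part.some (u p n)).map g

theorem comp_some {Φ : (Fin d → ℕ → ℕ) → ℕ →. ℕ} {u : (Fin d → ℕ → ℕ) → ℕ → ℕ}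
    (hΦ : OracleComputable O Φ)
    (hu : OracleComputable O fun p n => Part.some (u p n)) :
    OracleComputable O fun p n => Φ p (u p n) :=
  (comp hΦ hu).of_eq fun _ _ => Part.bind_some _ _

/-- The input tapes may be replaced by sequences that are themselves computed from them. -/
theorem subst {Φ : (Fin d → ℕ → ℕ) → ℕ →. ℕ} (hΦ : OracleComputable O Φ)
    {c : (Fin d → ℕ → ℕ) → Fin d → ℕ → ℕ}
    (hc : ∀ i, OracleComputable O fun p n => Part.some (c p i n)) :
    OracleComputable O fun p => Φ (c p) := by
  induction hΦ with
  | zero => exact zero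
  | succ => exact succ
  | left => exact left
  | right => exact right
  | oracle => exact oracle
  | input i => exact hc i
  | pair _ _ h₁ h₂ => exact pair h₁ h₂
  | comp _ _ h₁ h₂ => exact comp h₁ h₂
  | prec _ _ h₁ h₂ => exact prec h₁ h₂
  | rfind _ h => exact rfind h

end OracleComputable

/-- Two families of sequences have the same terms of index less than `N`. -/
def AgreeBelow {d : ℕ} (N : ℕ) (p p' : Fin d → ℕ → ℕ) : Prop :=
  ∀ i, ∀ j < N, p i j = p' i j

theorem agreeBelow_mem_nhds {d : ℕ} (N : ℕ) (p : Fin d → ℕ → ℕ) :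
    {p' | AgreeBelow N p p'} ∈ 𝓝 p := by
  have h : ∀ᶠ p' in 𝓝 p, ∀ i, ∀ j ∈ Set.Iio N, p i j = p' i j := by
    refine eventually_all.2 fun i => (Set.finite_Iio N).eventually_all.2 fun j _ => ?_
    have hc : ContinuousAt (fun p' : Fin d → ℕ → ℕ => p' i j) p := 
      (continuous_apply_apply i j).continuousAt
    have := hc.eventually_mem (s := {p i j}) (by simp)
    filter_upwards [this] with p' hp' using Eq.symm hp'
  exact h

/-- A halting computation reads only a finite part of the input tapes. -/
theorem OracleComputable.eventually_mem_of_agreeBelow {d : ℕ} {O : Set ℕ}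
    {Φ : (Fin d → ℕ → ℕ) → ℕ →. ℕ} (hΦ : OracleComputable O Φ) {p : Fin d → ℕ → ℕ} {n m : ℕ}
    (h : m ∈ Φ p n) : ∀ᶠ N in atTop, ∀ p', AgreeBelow N p p' → m ∈ Φ p' n := by
  induction hΦ generalizing n m with
  | zero => exact .of_forall fun _ _ _ => h
  | succ => exact .of_forall fun _ _ _ => h
  | left => exact .of_forall fun _ _ _ => h
  | right => exact .of_forall fun _ _ _ => h
  | oracle => exact .of_forall fun _ _ _ => h
  | input i =>
    filter_upwards [eventually_gt_atTop n] with N hN p' hp'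
    rwa [← hp' i n hN]
  | pair _ _ h₁ h₂ =>
    simp only [Seq.seq, Part.map_eq_map, Part.mem_bind_iff, Part.mem_map_iff] at h ⊢
    obtain ⟨_, ⟨a, ha, rfl⟩, b, hb, rfl⟩ := h
    filter_upwards [h₁ ha, h₂ hb] with N h₁ h₂ p' hp'
    exact ⟨_, ⟨a, h₁ p' hp', rfl⟩, b, h₂ p' hp', rfl⟩
  | comp _ _ h₁ h₂ =>
    obtain ⟨a, ha, hb⟩ := Part.mem_bind_iff.1 h
    filter_upwards [h₁ hb, h₂ ha] with N h₁ h₂ p' hp'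
    exact Part.mem_bind_iff.2 ⟨a, h₂ p' hp', h₁ p' hp'⟩
  | prec _ _ h₁ h₂ =>
    dsimp only at h ⊢
    generalize n.unpair.1 = a at h ⊢
    generalize n.unpair.2 = k at h ⊢
    induction k generalizing m with
    | zero => exact h₁ h
    | succ k ih =>
      simp only [Part.bind_eq_bind, Part.mem_bind_iff] at h ⊢
      obtain ⟨b, hb, hm⟩ := h
      filter_upwards [ih hb, h₂ hm] with N h₁ h₂ p' hp'
      exact ⟨b, h₁ p' hp', h₂ p' hp'⟩
  | rfind _ h₁ =>
    obtain ⟨hm, hlt⟩ := Nat.mem_rfind.1 h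
    simp only [Part.map_eq_map, Part.mem_map_iff] at hm hlt
    obtain ⟨a, ha, ha'⟩ := hm
    replace hlt := fun k (hk : k < m) => hlt hk
    choose! b hb hb' using hlt
    have hlt' : ∀ᶠ N in atTop, ∀ k ∈ Set.Iio m, ∀ p', AgreeBelow N p p' → b k ∈ _ :=
      (Set.finite_Iio m).eventually_all.2 fun k hk => h₁ (hb k hk)
    filter_upwards [h₁ ha, hlt'] with N h₁ h₂ p' hp'
    exact Nat.mem_rfind.2 ⟨Part.mem_map_iff _ |>.2 ⟨a, h₁ p' hp', ha'⟩,
      fun {k} hk => Part.mem_map_iff _ |>.2 ⟨_, h₂ k hk p' hp', hb' k hk⟩⟩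

/-- On a compact set of inputs on which the `m`-th output is always defined, one bound works for the
number of input symbols that determine this output. -/
theorem OracleComputable.exists_modulus {d : ℕ} {O : Set ℕ}
    {Φ : (Fin d → ℕ → ℕ) → ℕ →. ℕ} (hΦ : OracleComputable O Φ) {C : Set (Fin d → ℕ → ℕ)}
    (hC : IsCompact C) {m : ℕ} (hm : ∀ p ∈ C, (Φ p m).Dom) :
    ∃ N, ∀ p ∈ C, ∀ p', AgreeBelow N p p' → Φ p m = Φ p' m := by
  refine hC.induction_on
    (p := fun s => ∃ N, ∀ p ∈ s, ∀ p', AgreeBelow N p p' → Φ p m = Φ p' m) ⟨0, by simp⟩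
    (fun s t hst ⟨N, hN⟩ => ⟨N, fun p hp => hN p (hst hp)⟩) ?_ ?_
  · rintro s t ⟨N, hN⟩ ⟨N', hN'⟩
    refine ⟨max N N', ?_⟩
    rintro p (hp | hp) p' h
    · exact hN p hp p' fun i j hj => h i j (by omega)
    · exact hN' p hp p' fun i j hj => h i j (by omega)
  · intro p hp
    obtain ⟨N, hN⟩ := (hΦ.eventually_mem_of_agreeBelow (Part.get_mem (hm p hp))).exists
    refine ⟨_, mem_nhdsWithin_of_mem_nhds (agreeBelow_mem_nhds N p), N, fun p₁ h₁ p₂ h₂ => ?_⟩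
    have h₁ : AgreeBelow N p p₁ := h₁
    rw [Part.eq_some_iff.2 (hN p₁ h₁),
      Part.eq_some_iff.2 (hN p₂ fun i j hj => (h₁ i j hj).trans (h₂ i j hj))]

/-! ### Normalized names -/

theorem exists_fractionOfCode_eq (q : ℚ) : ∃ c, fractionOfCode c = q := by
  refine ⟨Nat.pair (Equiv.intEquivNat q.num) (q.den - 1), ?_⟩
  have h : ((q.den - 1 : ℕ) : ℚ) + 1 = q.den := by
    exact_mod_cast Nat.sub_add_cancel q.pos
  simp [fractionOfCode, h, Rat.num_div_den]

theorem exists_abs_sub_fractionOfCode_le (r : ℝ) {ε : ℝ} (hε : 0 < ε) :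
    ∃ c, |r - (fractionOfCode c : ℝ)| ≤ ε := by
  obtain ⟨q, h₁, h₂⟩ := exists_rat_btwn (lt_add_of_pos_right r hε)
  obtain ⟨c, rfl⟩ := exists_fractionOfCode_eq q
  exact ⟨c, abs_le.2 ⟨by linarith, by linarith⟩⟩

theorem exists_isName (r : ℝ) : ∃ p, IsName p r := by
  choose p hp using fun n : ℕ =>
    exists_abs_sub_fractionOfCode_le r (ε := (2 : ℝ)⁻¹ ^ n) (by positivity)
  exact ⟨p, hp⟩

theorem IsName.abs_sub_le {p q : ℕ → ℕ} {x y : ℝ} (hp : IsName p x) (hq : IsName q y) {n : ℕ}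
    (h : p n = q n) : |x - y| ≤ 2 * (2 : ℝ)⁻¹ ^ n := by
  have h₁ := abs_le.1 (hp n)
  have h₂ := abs_le.1 (hq n)
  rw [h] at h₁
  exact abs_le.2 ⟨by linarith, by linarith⟩

theorem exists_two_inv_pow_lt {ε : ℝ} (hε : 0 < ε) : ∃ n : ℕ, (2 : ℝ)⁻¹ ^ n < ε :=
  exists_pow_lt_of_lt_one hε (by norm_num)

theorem IsName.unique {p : ℕ → ℕ} {x y : ℝ} (hx : IsName p x) (hy : IsName p y) : x = y := by
  by_contra hne
  obtain ⟨n, hn⟩ := exists_two_inv_pow_lt (half_pos (abs_pos.2 (sub_ne_zero.2 hne)))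
  linarith [hx.abs_sub_le hy (n := n) rfl]

/-- The code of a fraction with denominator `2 ^ (n + 1)` close to the fraction coded by `c`: the
absolute value of the numerator is rounded down if the fraction is nonnegative, and up otherwise.
Under `Equiv.intEquivNat` the integer `a ≥ 0` is coded by `2 * a` and `-(a + 1)` by
`2 * a + 1`. -/
def roundCode (n c : ℕ) : ℕ :=
  Nat.pair (2 * ((c.unpair.1 / 2 + c.unpair.1 % 2) * 2 ^ (n + 1) / (c.unpair.2 + 1))
    + c.unpair.1 % 2) (2 ^ (n + 1) - 1)

theorem intEquivNat_symm_two_mul (a : ℕ) : Equiv.intEquivNat.symm (2 * a) = a := by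
  rw [Equiv.symm_apply_eq]; rfl

theorem intEquivNat_symm_two_mul_add_one (a : ℕ) :
    Equiv.intEquivNat.symm (2 * a + 1) = -((a : ℤ) + 1) := by
  rw [Equiv.symm_apply_eq, ← Int.negSucc_eq]; rfl

theorem two_pow_pred_cast_add_one (n : ℕ) : ((2 ^ n - 1 : ℕ) : ℝ) + 1 = 2 ^ n := by
  exact_mod_cast Nat.sub_add_cancel Nat.one_le_two_pow

theorem abs_fractionOfCode_sub_roundCode_le (n c : ℕ) :
    |(fractionOfCode c : ℝ) - (fractionOfCode (roundCode n c) : ℝ)| ≤ (2 : ℝ)⁻¹ ^ (n + 1) := by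
  have hT : (0 : ℝ) < 2 ^ (n + 1) := by positivity
  have hv : (0 : ℝ) < (c.unpair.2 : ℝ) + 1 := by positivity
  have key : ∀ a : ℕ,
      ((a * 2 ^ (n + 1) / (c.unpair.2 + 1) : ℕ) : ℝ) ≤ a * 2 ^ (n + 1) / (c.unpair.2 + 1) ∧
      (a : ℝ) * 2 ^ (n + 1) / (c.unpair.2 + 1) ≤
        (a * 2 ^ (n + 1) / (c.unpair.2 + 1) : ℕ) + 1 := by
    intro a
    constructor
    · have := @Nat.cast_div_le ℝ _ _ _ (a * 2 ^ (n + 1)) (c.unpair.2 + 1)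
      push_cast at this
      exact this
    · rw [div_le_iff₀ hv]
      exact_mod_cast (Nat.lt_div_mul_add (Nat.succ_pos _)).le.trans (by rw [add_mul, one_mul])
  have fin : ∀ s t : ℝ, |s * 2 ^ (n + 1) - t| ≤ 1 →
      |s - t / 2 ^ (n + 1)| ≤ (2 : ℝ)⁻¹ ^ (n + 1) := by
    intro s t h
    rw [inv_pow, ← one_div, le_div_iff₀ hT, ← abs_of_pos hT, ← abs_mul, sub_mul, abs_of_pos hT,
      div_mul_cancel₀ _ hT.ne']
    exact h
  unfold roundCode fractionOfCode
  rw [Nat.unpair_pair]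
  push_cast
  rw [two_pow_pred_cast_add_one]
  apply fin
  rcases Nat.even_or_odd' c.unpair.1 with ⟨a, ha | ha⟩
  · obtain ⟨h₁, h₂⟩ := key a
    rw [ha, show 2 * a / 2 + 2 * a % 2 = a by omega, show 2 * a % 2 = 0 by omega, add_zero,
      intEquivNat_symm_two_mul, intEquivNat_symm_two_mul, Int.cast_natCast, Int.cast_natCast,
      div_mul_eq_mul_div]
    exact abs_le.2 ⟨by linarith, by linarith⟩
  · obtain ⟨h₁, h₂⟩ := key (a + 1)
    rw [ha, show (2 * a + 1) / 2 + (2 * a + 1) % 2 = a + 1 by omega,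
      show (2 * a + 1) % 2 = 1 by omega,
      intEquivNat_symm_two_mul_add_one, intEquivNat_symm_two_mul_add_one]
    simp only [Int.cast_neg, Int.cast_add, Int.cast_one, Int.cast_natCast]
    rw [← Nat.cast_add_one, neg_div, neg_mul, div_mul_eq_mul_div]
    exact abs_le.2 ⟨by linarith, by linarith⟩

theorem primrec_roundCode : Nat.Primrec (Nat.unpaired roundCode) := by
  have hpow : Primrec₂ ((· ^ ·) : ℕ → ℕ → ℕ) := Primrec₂.unpaired'.1 Nat.Primrec.pow
  have h2 : Primrec fun x : ℕ × ℕ => 2 ^ (x.1 + 1) :=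
    hpow.comp (Primrec.const 2) (Primrec.succ.comp Primrec.fst)
  have hu : Primrec fun x : ℕ × ℕ => x.2.unpair := Primrec.unpair.comp Primrec.snd
  have ha : Primrec fun x : ℕ × ℕ => x.2.unpair.1 := Primrec.fst.comp hu
  have hm : Primrec fun x : ℕ × ℕ => x.2.unpair.1 % 2 := Primrec.nat_mod.comp ha (Primrec.const 2)
  have hn : Primrec₂ roundCode := by
    refine Primrec₂.natPair.comp (Primrec.nat_add.comp (Primrec.nat_mul.comp (Primrec.const 2)
      (Primrec.nat_div.comp (Primrec.nat_mul.comp (Primrec.nat_add.comp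
        (Primrec.nat_div.comp ha (Primrec.const 2)) hm) h2)
        (Primrec.succ.comp (Primrec.snd.comp hu)))) hm) (Primrec.nat_sub.comp h2 (Primrec.const 1))
  exact Primrec₂.unpaired'.2 hn

/-- The input tapes with their names rounded to dyadic fractions.  Looking up two entries ahead
leaves room for the rounding error. -/
def roundName {d : ℕ} (p : Fin d → ℕ → ℕ) (i : Fin d) (n : ℕ) : ℕ :=
  roundCode n (p i (n + 2))

theorem oracleComputable_roundName {d : ℕ} {O : Set ℕ} (i : Fin d) :
    OracleComputable O fun p n => Part.some (roundName p i n) := by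
  have h₂ : OracleComputable O fun (p : Fin d → ℕ → ℕ) n => Part.some (p i (n + 2)) :=
    (OracleComputable.input i).comp_some
      (.of_primrec (f := fun n => n + 2) (Nat.Primrec.succ.comp Nat.Primrec.succ))
  have h := (OracleComputable.of_primrec primrec_roundCode).comp_some
    ((OracleComputable.of_primrec Nat.Primrec.id).pair_some h₂)
  simpa [roundName] using h

/-- `p` is a name of `x`, with one sequence for each coordinate, within a tolerance which is the
fraction `t` of the one allowed, and with the `n`-th fractions having denominator `2 ^ (n + 1)`. -/
def IsDyadicName {d : ℕ} (t : ℝ) (p : Fin d → ℕ → ℕ) (x : EuclideanSpace ℝ (Fin d)) : Prop :=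
  ∀ i n, (p i n).unpair.2 = 2 ^ (n + 1) - 1 ∧
    |x i - (fractionOfCode (p i n) : ℝ)| ≤ t * (2 : ℝ)⁻¹ ^ n

theorem IsDyadicName.mono {d : ℕ} {t t' : ℝ} {p : Fin d → ℕ → ℕ} {x : EuclideanSpace ℝ (Fin d)}
    (h : IsDyadicName t p x) (htt' : t ≤ t') : IsDyadicName t' p x := fun i n =>
  ⟨(h i n).1, (h i n).2.trans (by gcongr)⟩

theorem IsDyadicName.isName {d : ℕ} {p : Fin d → ℕ → ℕ} {x : EuclideanSpace ℝ (Fin d)}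
    (h : IsDyadicName 1 p x) (i : Fin d) : IsName (p i) (x i) := fun n =>
  (h i n).2.trans (one_mul _).le

theorem isDyadicName_roundName {d : ℕ} {p : Fin d → ℕ → ℕ} {x : EuclideanSpace ℝ (Fin d)}
    (h : ∀ i, IsName (p i) (x i)) : IsDyadicName (3 / 4) (roundName p) x := by
  intro i n
  refine ⟨by simp [roundName, roundCode], ?_⟩
  refine (abs_sub_le _ (fractionOfCode (p i (n + 2)) : ℝ) _).trans ?_
  have h₁ := h i (n + 2)
  have h₂ := abs_fractionOfCode_sub_roundCode_le n (p i (n + 2))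
  simp only [pow_succ] at h₁ h₂
  simp only [roundName]
  linarith

theorem exists_isDyadicName {d : ℕ} (x : EuclideanSpace ℝ (Fin d)) :
    ∃ p, IsDyadicName (3 / 4) p x := by
  choose p hp using fun i => exists_isName (x i)
  exact ⟨_, isDyadicName_roundName hp⟩

theorem finite_setOf_abs_fractionOfCode_le (k : ℕ) (B : ℝ) :
    {c : ℕ | c.unpair.2 = k ∧ |(fractionOfCode c : ℝ)| ≤ B}.Finite := by
  have hk : (0 : ℝ) < k + 1 := by positivity
  set I : Set ℤ := Set.Icc ⌊-(B * (k + 1))⌋ ⌈B * (k + 1)⌉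
  refine ((Set.finite_Icc _ _ : I.Finite).image fun z => Nat.pair (Equiv.intEquivNat z) k).subset ?_
  rintro c ⟨rfl, hc⟩
  refine ⟨Equiv.intEquivNat.symm c.unpair.1, ?_, by simp⟩
  unfold fractionOfCode at hc
  push_cast at hc
  rw [abs_div, abs_of_pos hk, div_le_iff₀ hk, abs_le] at hc
  exact ⟨Int.cast_le.1 ((Int.floor_le _).trans hc.1 : _ ≤ ((_ : ℤ) : ℝ)),
    Int.cast_le.1 (hc.2.trans (Int.le_ceil _) : ((_ : ℤ) : ℝ) ≤ _)⟩

/-- The dyadic names of the points of a compact set form a compact set: dyadic denominators leave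
only finitely many possibilities for each entry. -/
theorem isCompact_setOf_isDyadicName {d : ℕ} {S : Set (EuclideanSpace ℝ (Fin d))}
    (hS : IsCompact S) : IsCompact {p : Fin d → ℕ → ℕ | ∃ x ∈ S, IsDyadicName 1 p x} := by
  obtain ⟨R, hR⟩ := hS.isBounded.exists_norm_le
  let A : ℕ → Set ℕ := fun n =>
    {c | c.unpair.2 = 2 ^ (n + 1) - 1 ∧ |(fractionOfCode c : ℝ)| ≤ R + 1}
  have hA : IsCompact (Set.univ.pi fun _ : Fin d => Set.univ.pi A) :=
    isCompact_univ_pi fun _ => isCompact_univ_pi fun n =>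
      (finite_setOf_abs_fractionOfCode_le _ _).isCompact
  have hclosed : IsClosed {z : (Fin d → ℕ → ℕ) × EuclideanSpace ℝ (Fin d) |
      IsDyadicName 1 z.1 z.2} := by
    simp only [IsDyadicName, Set.ofPred_forall, Set.ofPred_and]
    refine isClosed_iInter fun i => isClosed_iInter fun n => ?_
    have hev : Continuous fun z : (Fin d → ℕ → ℕ) × EuclideanSpace ℝ (Fin d) => z.1 i n :=
      (continuous_apply_apply i n).comp continuous_fst
    refine IsClosed.inter ((isClosed_discrete {c : ℕ | c.unpair.2 = 2 ^ (n + 1) - 1}).preimage hev)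
      (isClosed_le ?_ continuous_const)
    have hx : Continuous fun z : (Fin d → ℕ → ℕ) × EuclideanSpace ℝ (Fin d) => z.2 i := by
      fun_prop
    exact (hx.sub ((continuous_of_discreteTopology (f := fun c : ℕ =>
      (fractionOfCode c : ℝ))).comp hev)).abs
  convert ((hA.prod hS).inter_right hclosed).image continuous_fst using 1
  ext p
  simp only [Set.mem_ofPred_eq, Set.mem_image, Set.mem_inter_iff, Set.mem_prod, Prod.exists,
    exists_and_right, exists_eq_right]
  refine ⟨fun ⟨x, hx, hp⟩ => ⟨x, ⟨fun i _ n _ => ⟨(hp i n).1, ?_⟩, hx⟩, hp⟩,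
    fun ⟨x, h, hp⟩ => ⟨x, h.2, hp⟩⟩
  have h₁ := abs_le.1 (hp.isName i n)
  have h₂ := abs_le.1 ((PiLp.norm_apply_le x i).trans (hR x hx))
  have h₃ : (2 : ℝ)⁻¹ ^ n ≤ 1 := pow_le_one₀ (by norm_num) (by norm_num)
  exact abs_le.2 ⟨by linarith, by linarith⟩

/-! ### The values computed by a machine -/

/-- On input `p` the functional `Φ` produces a name of `y`. -/
def Outputs {d : ℕ} (Φ : (Fin d → ℕ → ℕ) → ℕ →. ℕ) (p : Fin d → ℕ → ℕ) (y : ℝ) : Prop :=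
  ∃ q : ℕ → ℕ, (∀ m, q m ∈ Φ p m) ∧ IsName q y

namespace Outputs

variable {d : ℕ} {Φ : (Fin d → ℕ → ℕ) → ℕ →. ℕ} {p p' : Fin d → ℕ → ℕ} {y y' : ℝ}

theorem dom (h : Outputs Φ p y) (m : ℕ) : (Φ p m).Dom :=
  Part.dom_iff_mem.2 ⟨_, h.choose_spec.1 m⟩

theorem unique (h : Outputs Φ p y) (h' : Outputs Φ p y') : y = y' := by
  obtain ⟨q, hq, hy⟩ := h
  obtain ⟨q', hq', hy'⟩ := h'
  obtain rfl : q = q' := funext fun m => Part.mem_unique (hq m) (hq' m)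
  exact hy.unique hy'

theorem abs_sub_le (h : Outputs Φ p y) (h' : Outputs Φ p' y') {m : ℕ} (hm : Φ p m = Φ p' m) :
    |y - y'| ≤ 2 * (2 : ℝ)⁻¹ ^ m := by
  obtain ⟨q, hq, hy⟩ := h
  obtain ⟨q', hq', hy'⟩ := h'
  exact hy.abs_sub_le hy' (Part.mem_unique (hq m) (hm ▸ hq' m))

end Outputs

/-- The output depends continuously on the input, so that compact sets of inputs lead to compact
sets of values. -/
theorem OracleComputable.isCompact_setOf_outputs {d : ℕ} {O : Set ℕ}
    {Φ : (Fin d → ℕ → ℕ) → ℕ →. ℕ} (hΦ : OracleComputable O Φ) {C : Set (Fin d → ℕ → ℕ)}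
    (hC : IsCompact C) (h : ∀ p ∈ C, ∃ y, Outputs Φ p y) :
    IsCompact {y | ∃ p ∈ C, Outputs Φ p y} := by
  choose! F hF using h
  have himage : {y | ∃ p ∈ C, Outputs Φ p y} = F '' C := by
    ext y
    exact ⟨fun ⟨p, hp, hy⟩ => ⟨p, hp, (hF p hp).unique hy⟩,
      fun ⟨p, hp, hy⟩ => ⟨p, hp, hy ▸ hF p hp⟩⟩
  rw [himage]
  refine hC.image_of_continuousOn fun p hp => Metric.tendsto_nhds.2 fun ε hε => ?_
  obtain ⟨m, hm⟩ := exists_two_inv_pow_lt (half_pos hε)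
  obtain ⟨N, hN⟩ := hΦ.exists_modulus hC fun p hp => (hF p hp).dom m
  filter_upwards [self_mem_nhdsWithin, mem_nhdsWithin_of_mem_nhds (agreeBelow_mem_nhds N p)]
    with p' hp' hpp'
  rw [Real.dist_eq, abs_sub_comm]
  linarith [(hF p hp).abs_sub_le (hF p' hp') (hN p hp p' hpp')]

namespace Multifunction

variable {d : ℕ} {K : Set (EuclideanSpace ℝ (Fin d))}

theorem ComputableRelativeTo.exists_outputs {O : Set ℕ} {f : Multifunction K ℝ}
    (hf : f.IsTotal) (h : f.ComputableRelativeTo O) :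
    ∃ Φ : (Fin d → ℕ → ℕ) → ℕ →. ℕ, OracleComputable O Φ ∧
      ∀ (x : K) p, IsDyadicName 1 p x.1 → ∃ y ∈ f x, Outputs Φ p y := by
  obtain ⟨Φ, hΦ, hΦf⟩ := h
  refine ⟨Φ, hΦ, fun x p hp => ?_⟩
  obtain ⟨q, hq, y, hy, hqy⟩ := hΦf x (hf ▸ Set.mem_univ x) p hp.isName
  exact ⟨y, hy, q, hq, hqy⟩

/-! ### Tightening to a multifunction that maps compact sets to compact sets -/

/-- A machine for `f` run on dyadic names only computes a tightening of `f` that maps compact sets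
to compact sets. -/
theorem ComputableRelativeTo.exists_mapsCompactToCompact {O : Set ℕ} {f : Multifunction K ℝ}
    (hf : f.IsTotal) (h : f.ComputableRelativeTo O) :
    ∃ g : Multifunction K ℝ, g.IsTotal ∧ g.Tightens f ∧ g.ComputableRelativeTo O ∧
      g.MapsCompactToCompact := by
  obtain ⟨Φ, hΦ, hout⟩ := h.exists_outputs hf
  let g : Multifunction K ℝ := fun x => {y | ∃ p, IsDyadicName 1 p x.1 ∧ Outputs Φ p y}
  have hg : g.IsTotal := by
    refine Set.eq_univ_of_forall fun x => ?_
    obtain ⟨p, hp⟩ := exists_isDyadicName x.1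
    have hp := hp.mono (t' := 1) (by norm_num)
    obtain ⟨y, -, hy⟩ := hout x p hp
    exact ⟨y, p, hp, hy⟩
  refine ⟨g, hg, ⟨hg ▸ Set.subset_univ _, fun x _ y ⟨p, hp, hy⟩ => ?_⟩,
    ⟨_, hΦ.subst oracleComputable_roundName, fun x _ p hp => ?_⟩, fun S hS => ?_⟩
  · obtain ⟨y', hy', hpy'⟩ := hout x p hp
    exact hy.unique hpy' ▸ hy'
  · have hp' := (isDyadicName_roundName hp).mono (t' := 1) (by norm_num)
    obtain ⟨y, -, hy⟩ := hout x _ hp'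
    obtain ⟨q, hq, hqy⟩ := hy
    exact ⟨q, hq, y, ⟨_, hp', q, hq, hqy⟩, hqy⟩
  · convert hΦ.isCompact_setOf_outputs
      (isCompact_setOf_isDyadicName (hS.image continuous_subtype_val)) ?_ using 1
    · ext y
      simp only [image, g, Set.mem_iUnion, Set.mem_ofPred_eq, Set.mem_image]
      constructor
      · rintro ⟨x, hx, p, hp, hy⟩
        exact ⟨p, ⟨x, ⟨x, hx, rfl⟩, hp⟩, hy⟩
      · rintro ⟨p, ⟨_, ⟨x, hx, rfl⟩, hp⟩, hy⟩
        exact ⟨x, hx, p, hp, hy⟩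
    · rintro p ⟨_, ⟨x, hx, rfl⟩, hp⟩
      obtain ⟨y, -, hy⟩ := hout x p hp
      exact ⟨y, hy⟩

/-! ### A winning strategy from a machine -/

/-- The names from which the second player computes his moves: a new name is started whenever the
opponent moves too far, and otherwise the first `N n` entries of the previous one are kept. -/
noncomputable def strategyName {X : Type*} [MetricSpace X] (canon : X → Fin d → ℕ → ℕ) (N : ℕ → ℕ)
    (δ : ℕ → ℝ) (x : ℕ → X) : ℕ → Fin d → ℕ → ℕ
  | 0 => canon (x 0)
  | n + 1 => fun i j =>
    open scoped Classical in
    if dist (x (n + 1)) (x n) ≤ δ n ∧ j < N n then strategyName canon N δ x n i j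
    else canon (x (n + 1)) i j

theorem strategyName_congr {X : Type*} [MetricSpace X] {canon : X → Fin d → ℕ → ℕ} {N : ℕ → ℕ}
    {δ : ℕ → ℝ} {x x' : ℕ → X} {n : ℕ} (h : ∀ k ≤ n, x k = x' k) :
    strategyName canon N δ x n = strategyName canon N δ x' n := by
  induction n with
  | zero => simp only [strategyName, h 0 le_rfl]
  | succ n ih =>
    simp only [strategyName, ih fun k hk => h k (by omega), h (n + 1) le_rfl, h n n.le_succ]

/-- The tolerances increase with `n` by at least the error which a move of length at most `δ n`
causes in the kept entries. -/
theorem isDyadicName_strategyName {canon : K → Fin d → ℕ → ℕ}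
    (hcanon : ∀ x : K, IsDyadicName (3 / 4) (canon x) x.1) (N : ℕ → ℕ) (x : ℕ → K) (n : ℕ) :
    IsDyadicName (1 - (2 : ℝ)⁻¹ ^ n / 4)
      (strategyName canon N (fun n => (2 : ℝ)⁻¹ ^ N n * (2 : ℝ)⁻¹ ^ n / 8) x n) (x n).1 := by
  induction n with
  | zero => exact (hcanon _).mono (by norm_num)
  | succ n ih =>
    have h₁ : (2 : ℝ)⁻¹ ^ (n + 1) ≤ 1 := pow_le_one₀ (by norm_num) (by norm_num)
    intro i j
    simp only [strategyName]
    split_ifs with h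
    · refine ⟨(ih i j).1, ?_⟩
      have hd : |(x (n + 1)).1 i - (x n).1 i| ≤ (2 : ℝ)⁻¹ ^ j * (2 : ℝ)⁻¹ ^ n / 8 := by
        refine (PiLp.norm_apply_le ((x (n + 1)).1 - (x n).1) i).trans ?_
        rw [← dist_eq_norm]
        refine h.1.trans ?_
        gcongr ?_ * _ / _
        exact pow_le_pow_of_le_one (by norm_num) (by norm_num) h.2.le
      refine (abs_sub_le _ ((x n).1 i) _).trans ((add_le_add hd (ih i j).2).trans (le_of_eq ?_))
      ring
    · exact (hcanon _).mono (by linarith) i j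

theorem ComputableRelativeTo.omegaHenkinContinuous (hK : IsCompact K) {O : Set ℕ}
    {f : Multifunction K ℝ} (hf : f.IsTotal) (h : f.ComputableRelativeTo O) :
    f.OmegaHenkinContinuous := by
  obtain ⟨Φ, hΦ, hout⟩ := h.exists_outputs hf
  -- Equal outputs with index `n + 2` force the values to be within `2 * 2⁻¹ ^ (n + 2)`, which is
  -- what the game allows in its `n`-th step.
  have hmod := fun n => hΦ.exists_modulus (m := n + 2) (isCompact_setOf_isDyadicName hK)
    fun p ⟨x, hx, hp⟩ => (hout ⟨x, hx⟩ p hp).choose_spec.2.dom _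
  choose N hN using hmod
  choose canon hcanon using fun x : K => exists_isDyadicName x.1
  set δ : ℕ → ℝ := fun n => (2 : ℝ)⁻¹ ^ N n * (2 : ℝ)⁻¹ ^ n / 8 with hδ
  let F : (Fin d → ℕ → ℕ) → ℝ := fun p => Classical.epsilon fun y => Outputs Φ p y
  have hP : ∀ (x : ℕ → K) n, IsDyadicName 1 (strategyName canon N δ x n) (x n).1 := fun x n =>
    (isDyadicName_strategyName hcanon N x n).mono (sub_le_self _ (by positivity))
  have hF : ∀ (x : K) p, IsDyadicName 1 p x.1 → F p ∈ f x ∧ Outputs Φ p (F p) := by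
    intro x p hp
    obtain ⟨y, hy, hpy⟩ := hout x p hp
    have hFp : Outputs Φ p (F p) := Classical.epsilon_spec (p := fun y => Outputs Φ p y) ⟨y, hpy⟩
    exact ⟨hFp.unique hpy ▸ hy, hFp⟩
  refine ⟨δ, fun n => by positivity,
    fun n x => F (strategyName canon N δ (fun k => x ⟨min k n, by omega⟩) n), fun x y hy => ?_⟩
  have hy' : ∀ n, y n = F (strategyName canon N δ x n) := fun n => by
    rw [hy n]
    exact congrArg F (strategyName_congr fun k hk => congrArg x (min_eq_left hk))
  refine ⟨hy' 0 ▸ (hF _ _ (hP x 0)).1, fun n hn => ⟨hy' (n + 1) ▸ (hF _ _ (hP x (n + 1))).1, ?_⟩⟩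
  have hagree :
      AgreeBelow (N n) (strategyName canon N δ x n) (strategyName canon N δ x (n + 1)) := by
    intro i j hj
    exact (if_pos ⟨Metric.mem_closedBall.1 hn, hj⟩).symm
  have := (hF _ _ (hP x n)).2.abs_sub_le (hF _ _ (hP x (n + 1))).2
    (hN n _ ⟨_, (x n).2, hP x n⟩ _ hagree)
  rw [Metric.mem_closedBall, hy', hy', Real.dist_eq, abs_sub_comm]
  refine this.trans (le_of_eq ?_)
  ring

end Multifunction

/-! ### Oracles for functionals with a modulus -/

/-- A code of the first `k` terms of a sequence. -/
def prefixCode (q : ℕ → ℕ) : ℕ → ℕ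
  | 0 => 0
  | k + 1 => Nat.pair (prefixCode q k) (q k)

theorem eq_of_prefixCode_eq {q q' : ℕ → ℕ} {k : ℕ} (h : prefixCode q k = prefixCode q' k) :
    ∀ j < k, q j = q' j := by
  induction k with
  | zero => intro j hj; omega
  | succ k ih =>
    obtain ⟨h₁, h₂⟩ := Nat.pair_eq_pair.1 h
    intro j hj
    rcases Nat.lt_succ_iff_lt_or_eq.1 hj with hj | rfl
    · exact ih h₁ j hj
    · exact h₂

/-- A code of the first `k` terms of the sequences `p i` for the `i` in the list `l`. -/
def prefixesCode {d : ℕ} (p : Fin d → ℕ → ℕ) (k : ℕ) (l : List (Fin d)) : ℕ :=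
  l.foldr (fun i c => Nat.pair (prefixCode (p i) k) c) 0

theorem eq_of_prefixesCode_eq {d : ℕ} {p p' : Fin d → ℕ → ℕ} {k : ℕ} {l : List (Fin d)}
    (h : prefixesCode p k l = prefixesCode p' k l) : ∀ i ∈ l, ∀ j < k, p i j = p' i j := by
  induction l with
  | nil => simp
  | cons i l ih =>
    obtain ⟨h₁, h₂⟩ := Nat.pair_eq_pair.1 h
    exact List.forall_mem_cons.2 ⟨eq_of_prefixCode_eq h₁, ih h₂⟩

/-- A code of the number `k` and of the first `k` symbols on each input tape. -/
def inputCode {d : ℕ} (p : Fin d → ℕ → ℕ) (k : ℕ) : ℕ :=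
  Nat.pair k (prefixesCode p k (List.finRange d))

theorem inputCode_eq_inputCode {d : ℕ} {p p' : Fin d → ℕ → ℕ} {k k' : ℕ}
    (h : inputCode p k = inputCode p' k') : k = k' ∧ AgreeBelow k p p' := by
  obtain ⟨rfl, h⟩ := Nat.pair_eq_pair.1 h
  exact ⟨rfl, fun i => eq_of_prefixesCode_eq h i (List.mem_finRange i)⟩

namespace OracleComputable

variable {d : ℕ} {O : Set ℕ}

theorem prefixCode (i : Fin d) :
    OracleComputable O fun p k => Part.some (_root_.prefixCode (p i) k) := by
  have hindex : OracleComputable O fun (_ : Fin d → ℕ → ℕ) n =>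
      Part.some n.unpair.2.unpair.1 := left.comp_some right
  have hstep : OracleComputable O fun (p : Fin d → ℕ → ℕ) n =>
      Part.some (Nat.pair n.unpair.2.unpair.2 (p i n.unpair.2.unpair.1)) :=
    (comp_some right right).pair_some ((input i).comp_some hindex)
  have h := (prec zero hstep).comp_some
    (pair_some zero (of_primrec Nat.Primrec.id))
  refine h.of_eq fun p k => ?_
  simp only [Nat.unpair_pair, id]
  induction k with
  | zero => rfl
  | succ k ih =>
    exact (congrArg (fun c : Part ℕ => c.bind fun c => Part.some (Nat.pair c (p i k))) ih).trans
      (Part.bind_some _ _)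

theorem inputCode :
    OracleComputable O fun (p : Fin d → ℕ → ℕ) k => Part.some (_root_.inputCode p k) := by
  refine pair_some (of_primrec Nat.Primrec.id) ?_
  induction List.finRange d with
  | nil => exact zero
  | cons i l ih => exact (prefixCode i).pair_some ih

/-- The oracle consists of the triples not of the form (output index, initial segment of the input,
output), and the machine searches for a triple missing from it. -/
theorem exists_of_modulus {d : ℕ} (Q : ℕ → (Fin d → ℕ → ℕ) → ℕ) (k : ℕ → ℕ)
    (hQ : ∀ m p p', AgreeBelow (k m) p p' → Q m p = Q m p') :
    ∃ O, OracleComputable O fun p m => Part.some (Q m p) := by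
  classical
  -- Minimization looks for zeros, hence the complement.
  let O : Set ℕ :=
    {e | ¬ ∃ m p, e = Nat.pair m (Nat.pair (_root_.inputCode p (k m)) (Q m p))}
  have hquery : OracleComputable O fun (p : Fin d → ℕ → ℕ) n => Part.some
      (O.indicator (fun _ => 1) (Nat.pair n.unpair.1
        (Nat.pair (_root_.inputCode p n.unpair.2.unpair.1) n.unpair.2.unpair.2))) :=
    oracle.comp_some (left.pair_some ((inputCode.comp_some (left.comp_some right)).pair_some
      (right.comp_some right)))
  refine ⟨O, ?_⟩
  refine (right.comp hquery.rfind).of_eq fun p m => ?_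
  set A : ℕ →. Bool := fun n => (fun m => decide (m = 0)) <$> Part.some
    (O.indicator (fun _ => 1) (Nat.pair (Nat.pair m n).unpair.1
      (Nat.pair (_root_.inputCode p (Nat.pair m n).unpair.2.unpair.1)
        (Nat.pair m n).unpair.2.unpair.2))) with hA
  have hAn : ∀ n, A n = Part.some (decide (Nat.pair m
      (Nat.pair (_root_.inputCode p n.unpair.1) n.unpair.2) ∉ O)) := by
    intro n
    simp only [hA, Part.map_eq_map, Part.map_some, Nat.unpair_pair, Set.indicator_apply_eq_zero,
      one_ne_zero, imp_false]
  have hdom : (Nat.rfind A).Dom := by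
    refine Nat.rfind_dom.2 ⟨Nat.pair (k m) (Q m p), ?_, fun {n} _ => hAn n ▸ trivial⟩
    rw [hAn, Part.mem_some_iff, eq_comm, decide_eq_true_iff, Nat.unpair_pair]
    exact not_not.2 ⟨m, p, rfl⟩
  have hspec := Nat.rfind_spec (Part.get_mem hdom)
  generalize hn : (Nat.rfind A).get hdom = n at hspec
  rw [hAn, Part.mem_some_iff, eq_comm, decide_eq_true_iff] at hspec
  obtain ⟨m', p', h⟩ := not_not.1 hspec
  obtain ⟨rfl, h⟩ := Nat.pair_eq_pair.1 h
  obtain ⟨h, h'⟩ := Nat.pair_eq_pair.1 h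
  obtain ⟨hk, hpp'⟩ := inputCode_eq_inputCode h
  rw [hQ m p p' (hk ▸ hpp'), ← h', Part.get_eq_iff_eq_some.1 hn]
  exact Part.bind_some _ _

end OracleComputable

/-! ### From a winning strategy to a machine -/

theorem dist_le_of_forall_abs_sub_le {d : ℕ} {x z : EuclideanSpace ℝ (Fin d)} {r : ℝ} (hr : 0 ≤ r)
    (h : ∀ i, |x i - z i| ≤ r) : dist x z ≤ (d + 1) * r := by
  rw [EuclideanSpace.dist_eq]
  refine Real.sqrt_le_iff.2 ⟨by positivity, ?_⟩
  have : ∑ i, dist (x i) (z i) ^ 2 ≤ ∑ _i : Fin d, r ^ 2 :=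
    Finset.sum_le_sum fun i _ => by
      rw [Real.dist_eq]
      exact pow_le_pow_left₀ (abs_nonneg _) (h i) 2
  refine this.trans ?_
  rw [Finset.sum_const, Finset.card_univ, Fintype.card_fin, nsmul_eq_mul, mul_pow]
  gcongr
  nlinarith [(Nat.cast_nonneg d : (0 : ℝ) ≤ d)]

/-- The points `X p n`, which depend on the initial segments of a name `p` of `x`, converge to `x`
at a prescribed rate. -/
theorem exists_approximating_sequence {d : ℕ} (K : Set (EuclideanSpace ℝ (Fin d))) [Nonempty K]
    {δ : ℕ → ℝ} (hδ : ∀ n, 0 < δ n) :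
    ∃ (X : (Fin d → ℕ → ℕ) → ℕ → K) (k : ℕ → ℕ),
      (∀ n p p', AgreeBelow (k n) p p' → ∀ j ≤ n, X p j = X p' j) ∧
      ∀ (x : K) p, (∀ i, IsName (p i) (x.1 i)) → ∀ n, ∀ j ≤ n, dist (X p n) x ≤ δ j := by
  choose ν hν using fun n => exists_two_inv_pow_lt (ε := δ n / (2 * (d + 1)))
    (div_pos (hδ n) (by positivity))
  let r : ℕ → ℕ := fun n => ∑ j ∈ Finset.range (n + 1), ν j
  have hr : ∀ n, ∀ j ≤ n, ν j ≤ r n := fun n j hj =>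
    Finset.single_le_sum (fun _ _ => Nat.zero_le _) (Finset.mem_range.2 (by omega))
  have hrm : Monotone r := fun n n' h =>
    Finset.sum_le_sum_of_subset (Finset.range_mono (by omega))
  let P : (Fin d → ℕ → ℕ) → ℕ → K → Prop := fun p n z =>
    ∀ i, |z.1 i - (fractionOfCode (p i (r n)) : ℝ)| ≤ (2 : ℝ)⁻¹ ^ r n
  refine ⟨fun p n => Classical.epsilon (P p n), fun n => r n + 1, fun n p p' h j hj => ?_,
    fun x p hp n j hj => ?_⟩
  · have : P p j = P p' j := by
      funext z
      simp only [P, h _ (r j) (Nat.lt_succ_of_le (hrm hj))]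
    simp only [this]
  · have hX : P p n (Classical.epsilon (P p n)) :=
      Classical.epsilon_spec (p := P p n) ⟨x, fun i => hp i (r n)⟩
    have hpow : (2 : ℝ)⁻¹ ^ r n ≤ (2 : ℝ)⁻¹ ^ ν j :=
      pow_le_pow_of_le_one (by norm_num) (by norm_num) (hr n j hj)
    refine (dist_le_of_forall_abs_sub_le (r := 2 * (2 : ℝ)⁻¹ ^ ν j) (by positivity)
      fun i => ?_).trans ?_
    · have h₁ := abs_le.1 (hX i)
      have h₂ := abs_le.1 (hp i (r n))
      exact abs_le.2 ⟨by linarith, by linarith⟩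
    · have := (lt_div_iff₀ (by positivity)).1 (hν j)
      linarith

namespace Multifunction

variable {d : ℕ} {K : Set (EuclideanSpace ℝ (Fin d))}

/-- A machine with a suitable oracle plays the winning strategy against points approximating `x`
and outputs the limit of the answers.  Since each answer `y n` also has to cope with the opponent
jumping to `x` itself, there are points of `f x` close to `y n`, so the limit is in `f x`. -/
theorem OmegaHenkinContinuous.relativelyComputable {f : Multifunction K ℝ}
    (hclosed : ∀ x, IsClosed (f x)) (h : f.OmegaHenkinContinuous) : f.RelativelyComputable := by
  cases isEmpty_or_nonempty K with
  | inl _ => exact ⟨∅, _, .zero, fun x => isEmptyElim x⟩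
  | inr _ =>
  obtain ⟨δ, hδ, s, hs⟩ := h
  obtain ⟨X, k, hk, hX⟩ := exists_approximating_sequence K fun n => half_pos (hδ n)
  let Y : (Fin d → ℕ → ℕ) → ℕ → ℝ := fun p n => s n fun i => X p i
  choose code hcode using fun (n : ℕ) (r : ℝ) =>
    exists_abs_sub_fractionOfCode_le r (ε := (2 : ℝ)⁻¹ ^ n) (by positivity)
  obtain ⟨O, hO⟩ := OracleComputable.exists_of_modulus (d := d)
    (fun m p => code (m + 1) (Y p (m + 1))) (fun m => k (m + 1)) fun m p p' h => by
      have : Y p (m + 1) = Y p' (m + 1) :=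
        congrArg (s (m + 1)) (funext fun i => hk _ _ _ h i (Nat.lt_succ_iff.1 i.2))
      simp only [this]
  refine ⟨O, _, hO, fun x _ p hp => ⟨_, fun m => Part.mem_some _, ?_⟩⟩
  have hXx := hX x p hp
  have hstep : ∀ n, dist (Y p n) (Y p (n + 1)) ≤ 1 / 2 / 2 ^ n := by
    intro n
    have hball : X p (n + 1) ∈ Metric.closedBall (X p n) (δ n) := by
      have := dist_triangle_right (X p (n + 1)) (X p n) x
      exact Metric.mem_closedBall.2 (by linarith [hXx (n + 1) n n.le_succ, hXx n n le_rfl])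
    have := ((hs (X p) (Y p) fun _ => rfl).2 n hball).2
    rw [Metric.mem_closedBall, dist_comm] at this
    refine this.trans (le_of_eq ?_)
    rw [pow_succ, inv_pow]
    ring
  obtain ⟨y, hy⟩ := cauchySeq_tendsto_of_complete (cauchySeq_of_le_geometric_two hstep)
  have hYy : ∀ n, dist (Y p n) y ≤ (2 : ℝ)⁻¹ ^ n := fun n =>
    (dist_le_of_le_geometric_two_of_tendsto hstep hy n).trans (by rw [one_div, inv_pow])
  refine ⟨y, Metric.mem_of_closed' (hclosed x) |>.2 fun ε hε => ?_, fun m => ?_⟩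
  · obtain ⟨n, hn⟩ := exists_two_inv_pow_lt (half_pos hε)
    -- The opponent follows the approximating points up to index `n` and then jumps to `x`.
    let x' : ℕ → K := fun j => if j ≤ n then X p j else x
    have hx'n : x' n = X p n := if_pos le_rfl
    have hx' : x' (n + 1) = x := if_neg (by omega)
    have hy'n : s n (fun i => x' i) = Y p n :=
      congrArg (s n) (funext fun i => if_pos (Nat.lt_succ_iff.1 i.2))
    have hwin := (hs x' (fun j => s j fun i => x' i) fun _ => rfl).2 n
    simp only [hx', hx'n, hy'n] at hwin
    obtain ⟨h₁, h₂⟩ := hwin (by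
      rw [Metric.mem_closedBall, dist_comm]
      linarith [hXx n n le_rfl, hδ n])
    refine ⟨_, h₁, ?_⟩
    rw [Metric.mem_closedBall, pow_succ] at h₂
    have := dist_triangle_right y (s (n + 1) fun i => x' i) (Y p n)
    linarith [dist_comm y (Y p n), hYy n]
  · have h₁ := hcode (m + 1) (Y p (m + 1))
    have h₂ := hYy (m + 1)
    rw [dist_comm, Real.dist_eq] at h₂
    refine (abs_sub_le _ (Y p (m + 1)) _).trans ((add_le_add h₂ h₁).trans (le_of_eq ?_))
    ring

theorem MapsCompactToCompact.isClosed {X Y : Type*} [TopologicalSpace X] [TopologicalSpace Y]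
    [T2Space Y] {f : Multifunction X Y} (h : f.MapsCompactToCompact) (x : X) : IsClosed (f x) := by
  simpa [image] using (h {x} isCompact_singleton).isClosed

end Multifunction

theorem theorem4 {d : ℕ} (K : Set (EuclideanSpace ℝ (Fin d))) (hK : IsCompact K) :
    (∀ (O : Set ℕ) (f : Multifunction K ℝ), f.IsTotal → f.ComputableRelativeTo O →
      ∃ g : Multifunction K ℝ, g.IsTotal ∧ g.Tightens f ∧ g.ComputableRelativeTo O ∧
        g.MapsCompactToCompact) ∧
    (∀ f : Multifunction K ℝ, f.IsTotal → f.RelativelyComputable → f.OmegaHenkinContinuous) ∧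
    (∀ f : Multifunction K ℝ, f.IsTotal → f.MapsCompactToCompact → f.OmegaHenkinContinuous →
      f.RelativelyComputable) := by
  refine ⟨fun O f hf h => h.exists_mapsCompactToCompact hf, fun f hf ⟨O, h⟩ =>
    h.omegaHenkinContinuous hK hf, fun f _ hc h => h.relativelyComputable hc.isClosed⟩
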